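/- Let $K$ be a field, let $m,n,r$ be integers with $1\le r\le\min\{m,n\}$, and let $X=(X_{ij})$ be an $m\times n$ matrix of indeterminates over $K$. Let $I_{r+1}\subseteq K[X]$ be the ideal generated by the $(r+1)$-minors of $X$ (so $I_{r+1}=0$ if $r=\min\{m,n\}$), and let $R_{r+1}=K[X]/I_{r+1}$. Let $Y$ be an $m\times r$ matrix and $Z$ an $r\times n$ matrix of independent indeterminates over $K$, and let $K[YZ]$ be the $K$-subalgebra of $K[Y,Z]$ generated by the entries of the product matrix $YZ$. For $t\ge 1$, $1\le a_1<\dots<a_t\le m$ and $1\le b_1<\dots<b_t\le n$, let $[a_1\dots a_t\,|\,b_1\dots b_t]$ denote the minor $\det(X_{a_ib_j})_{1\le i,j\le t}$, of size $t$. Write $[a_1\dots a_t\,|\,b_1\dots b_t]\preceq[c_1\dots c_u\,|\,d_1\dots d_u]$ if $t\ge u$ and $a_i\le c_i$, $b_i\le d_i$ for $i=1,\dots,u$. A standard bitableau is a product $\Sigma=\delta_1\cdots\delta_w$ ($w\ge 0$) of minors with $\delta_1\preceq\dots\preceq\delta_w$; let $\mathcal S_r$ be the set of all standard bitableaux all of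 whose factors have size at most $r$ (including the empty product $1$). Then: (a) The $K$-algebra homomorphism $\varphi: R_{r+1}\to K[YZ]$ induced by the substitution $X_{ij}\mapsto (YZ)_{ij}$ is (well defined and) an isomorphism. (b) The residue classes of the standard bitableaux $\Sigma\in\mathcal S_r$ form a $K$-basis of $R_{r+1}$; here the basis is indexed by the sequences $(\delta_1,\dots,\delta_w)$, so in particular distinct sequences have distinct residue classes. -/

import Mathlib

noncomputable section

namespace Determinantal

/-- The index data `[a₁ … a_t | b₁ … b_t]` of a minor of an `m × n` matrix: a size `t ≥ 1`
together with strictly increasing row indices and strictly increasing column indices. -/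
structure Minor (m n : ℕ) where
  size : ℕ
  size_pos : 0 < size
  rows : Fin size ↪o Fin m
  cols : Fin size ↪o Fin n

/-- The value of a minor on an `m × n` matrix `A`, that is, the determinant of the submatrix
of `A` with the given rows and columns. -/
def Minor.value {m n : ℕ} {B : Type*} [CommRing B] (δ : Minor m n)
    (A : Matrix (Fin m) (Fin n) B) : B :=
  (A.submatrix δ.rows δ.cols).det

/-- `[a₁ … a_t | b₁ … b_t] ≼ [c₁ … c_u | d₁ … d_u]` iff `t ≥ u` and `a_i ≤ c_i`, `b_i ≤ d_i` for
`i = 1, …, u`. -/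
def Minor.Le {m n : ℕ} (δ ε : Minor m n) : Prop :=
  ∃ h : ε.size ≤ δ.size, ∀ i : Fin ε.size,
    δ.rows (Fin.castLE h i) ≤ ε.rows i ∧ δ.cols (Fin.castLE h i) ≤ ε.cols i

/-- A list of minors `δ₁, …, δ_w` is standard if `δ₁ ≼ ⋯ ≼ δ_w`. (Then the sizes are
automatically non-increasing; the empty list is standard.) -/
def IsStandard {m n : ℕ} (L : List (Minor m n)) : Prop :=
  L.IsChain Minor.Le

/-- The set `𝒮_r` of standard bitableaux of shape bounded by `r`. As the sizes
are non-increasing, bounding every size by `r` is the same as bounding the first one. -/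
def StandardBitableau (m n r : ℕ) : Type :=
  {L : List (Minor m n) // IsStandard L ∧ ∀ δ ∈ L, δ.size ≤ r}

/-- The element `Σ_A`: the product of the values on `A` of the minors of `Σ`. -/
def StandardBitableau.value {m n r : ℕ} {B : Type*} [CommRing B] (S : StandardBitableau m n r)
    (A : Matrix (Fin m) (Fin n) B) : B :=
  (S.1.map fun δ => δ.value A).prod

variable (K : Type*) [Field K]

/-- The ideal `I_t(X)` of `K[X]` generated by the `t`-minors of the generic `m × n` matrix `X`
(the zero ideal if `t > min m n`, because then there are no `t`-minors). -/
def detIdeal (m n t : ℕ) : Ideal (MvPolynomial (Fin m × Fin n) K) :=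
  Ideal.span {f | ∃ δ : Minor m n, δ.size = t ∧
    f = δ.value (Matrix.mvPolynomialX (Fin m) (Fin n) K)}

/-- The determinantal ring `R_{r+1} = K[X] / I_{r+1}(X)`, indexed so that
`DetRing K m n r` is `R_{r+1}`. -/
abbrev DetRing (m n r : ℕ) : Type _ :=
  MvPolynomial (Fin m × Fin n) K ⧸ detIdeal K m n (r + 1)

/-- The polynomial ring `K[Y, Z]`. -/
abbrev PolyYZ (m n r : ℕ) : Type _ :=
  MvPolynomial ((Fin m × Fin r) ⊕ (Fin r × Fin n)) K

/-- The `m × r` matrix `Y` of indeterminates. -/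
def matY (m n r : ℕ) : Matrix (Fin m) (Fin r) (PolyYZ K m n r) :=
  Matrix.of fun i k => MvPolynomial.X (Sum.inl (i, k))

/-- The `r × n` matrix `Z` of indeterminates. -/
def matZ (m n r : ℕ) : Matrix (Fin r) (Fin n) (PolyYZ K m n r) :=
  Matrix.of fun k j => MvPolynomial.X (Sum.inr (k, j))

/-- The product matrix `YZ`. -/
def matYZ (m n r : ℕ) : Matrix (Fin m) (Fin n) (PolyYZ K m n r) :=
  matY K m n r * matZ K m n r

/-- The `K`-subalgebra `K[YZ]` of `K[Y, Z]` generated by the entries of `YZ`. -/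
def algYZ (m n r : ℕ) : Subalgebra K (PolyYZ K m n r) :=
  Algebra.adjoin K {f | ∃ i j, f = matYZ K m n r i j}

/-- The `K`-algebra homomorphism `K[X] → K[YZ]` with `X_ij ↦ (YZ)_ij`. -/
def substYZ (m n r : ℕ) : MvPolynomial (Fin m × Fin n) K →ₐ[K] algYZ K m n r :=
  MvPolynomial.aeval fun p =>
    ⟨matYZ K m n r p.1 p.2, Algebra.subset_adjoin ⟨p.1, p.2, rfl⟩⟩

variable {K}

theorem substYZ_value {m n r : ℕ} (δ : Minor m n) :
    (substYZ K m n r (δ.value (Matrix.mvPolynomialX (Fin m) (Fin n) K)) : PolyYZ K m n r)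
      = δ.value (matYZ K m n r) := by
  have h : (substYZ K m n r (δ.value (Matrix.mvPolynomialX (Fin m) (Fin n) K)) : PolyYZ K m n r)
      = ((algYZ K m n r).val.comp (substYZ K m n r))
          (δ.value (Matrix.mvPolynomialX (Fin m) (Fin n) K)) := rfl
  rw [h, Minor.value, Minor.value, AlgHom.map_det]
  congr 1
  ext i j : 2
  simp [substYZ, Matrix.mvPolynomialX]

theorem value_matYZ_eq_zero {m n r : ℕ} (δ : Minor m n) (hδ : r < δ.size) :
    δ.value (matYZ K m n r) = 0 := by
  have h : (matYZ K m n r).submatrix δ.rows δ.cols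
      = (matY K m n r).submatrix δ.rows id * (matZ K m n r).submatrix id δ.cols := by
    ext i j : 2
    simp [matYZ, Matrix.mul_apply]
  rw [Minor.value, h]
  by_contra hne
  have hinj : Function.Injective ((matZ K m n r).submatrix id δ.cols).mulVecLin := by
    refine (injective_iff_map_eq_zero _).2 fun v hv => ?_
    by_contra hv0
    refine hne (Matrix.exists_mulVec_eq_zero_iff.1 ⟨v, hv0, ?_⟩)
    rw [← Matrix.mulVec_mulVec]
    rw [Matrix.mulVecLin_apply] at hv
    rw [hv, Matrix.mulVec_zero]
  have hcard := card_le_of_injective (PolyYZ K m n r) _ hinj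
  simp only [Fintype.card_fin] at hcard
  omega

theorem substYZ_eq_zero {m n r : ℕ} (f : MvPolynomial (Fin m × Fin n) K)
    (hf : f ∈ detIdeal K m n (r + 1)) : substYZ K m n r f = 0 := by
  have hle : detIdeal K m n (r + 1) ≤ RingHom.ker (substYZ K m n r) := by
    refine Ideal.span_le.2 ?_
    rintro _ ⟨δ, hδ, rfl⟩
    refine (RingHom.mem_ker).2 (Subtype.ext ?_)
    rw [substYZ_value, value_matYZ_eq_zero δ (by omega)]
    rfl
  exact hle hf

variable (K)

/-- The homomorphism `φ : R_{r+1} → K[YZ]` induced by the substitution `X ↦ YZ`. -/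
def genericPoint (m n r : ℕ) : DetRing K m n r →ₐ[K] algYZ K m n r :=
  Ideal.Quotient.liftₐ (detIdeal K m n (r + 1)) (substYZ K m n r) substYZ_eq_zero

end Determinantal

end

/-!
Both assertions follow from two facts: the standard bitableaux with factors of size at most `r`
span `R_{r+1}`, and their images under `X ↦ YZ` are linearly independent in `K[Y, Z]`. Then they
form a basis of `R_{r+1}` which `φ` maps to an independent family, so `φ` is injective; it is
surjective because its image contains the generators of `K[YZ]`.

*Spanning.* Append the antidiagonal `m × m` unit matrix to `X`. Up to sign, the minors of `X` are
the maximal minors of this `m × (n + m)` matrix (`maxMinor_extendedCols`), apart from the one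
formed by the unit columns, which is `±1`; the order on minors corresponds to the entrywise order
on column indices (`toMinor_le`). Products of maximal minors are straightened by exchange relations
(`maxMinor_mul_mem_span`): if `c_k > d_k`, alternating the `m + 1` columns
`d_1, …, d_k, c_k, …, c_m` in `[c][d]` gives zero, and every term other than `[c][d]` has a first
factor with smaller index sum. A weighted index sum (`potential`) shows that this terminates. In
`R_{r+1}` the products with a factor of size greater than `r` vanish (`value_mem_detIdeal`).

*Independence.* For a suitable lexicographic order, the leading monomial of the minor
`[a_1 … a_t | b_1 … b_t]` of `YZ` is `∏ Y_{a_i, i} Z_{i, b_i}`, as one sees from the Cauchy-Binet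
expansion (`value_matYZ_monic`). The leading monomial of a standard bitableau therefore records, for
each `i`, the multisets of the `i`-th row indices and of the `i`-th column indices of its factors.
These determine the least factor, and by induction the whole bitableau (`sum_leadExp_injective`).
-/

noncomputable section

namespace Determinantal

/-! ### Exchange relations for maximal minors -/

/-- The alternating map obtained from `f` by keeping the arguments outside `P` fixed. -/
def fixArguments {R V N ι : Type*} [CommRing R] [AddCommGroup V] [Module R V] [AddCommGroup N]
    [Module R N] (f : V [⋀^ι]→ₗ[R] N) (P : ι → Prop) [DecidablePred P] (z : ι → V) :
    V [⋀^{i // P i}]→ₗ[R] N :=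
  { f.toMultilinearMap.domDomRestrict P (fun i => z i) with
    map_eq_zero_of_eq' := by
      intro x i j hx hij
      refine f.map_eq_zero_of_eq _ (i := i) (j := j) ?_ (fun h => hij (Subtype.ext h))
      simp [i.2, j.2, hx] }

theorem fixArguments_apply {R V N ι : Type*} [CommRing R] [AddCommGroup V] [Module R V]
    [AddCommGroup N] [Module R N] (f : V [⋀^ι]→ₗ[R] N) (P : ι → Prop) [DecidablePred P] (z : ι → V)
    (x : {i // P i} → V) :
    fixArguments f P z x = f fun i => if h : P i then x ⟨i, h⟩ else z i :=
  rfl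

/-- An alternating map in more arguments than the rank of the module vanishes. -/
theorem alternatingMap_eq_zero_of_card_lt {R N ι κ : Type*} [CommRing R] [AddCommGroup N]
    [Module R N] [Fintype ι] [Fintype κ] (h : Fintype.card κ < Fintype.card ι)
    (f : (κ → R) [⋀^ι]→ₗ[R] N) : f = 0 := by
  refine Module.Basis.ext_alternating (Pi.basisFun R κ) fun v hv => ?_
  exact absurd (Fintype.card_le_of_injective v hv) (by omega)

/-- If every value of `f` on the left summand exceeds every value on the right one, a permutation
that does not preserve the summands decreases the sum over the left one. -/
theorem sum_perm_inl_lt {α β : Type*} [Fintype α] [Fintype β]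
    (f : α ⊕ β → ℕ) (t : ℕ) (hl : ∀ a, t < f (.inl a)) (hr : ∀ b, f (.inr b) ≤ t)
    (σ : Equiv.Perm (α ⊕ β)) (hσ : σ ∉ (Equiv.Perm.sumCongrHom α β).range) :
    ∑ a, f (σ (.inl a)) < ∑ a, f (.inl a) := by
  have hσ' : ∃ b a, σ (.inr b) = .inl a := by
    by_contra hcon
    push Not at hcon
    refine hσ (Equiv.Perm.mem_sumCongrHom_range_of_perm_mapsTo_inl
      ((Equiv.Perm.perm_mapsTo_inl_iff_mapsTo_inr σ).2 ?_))
    rintro _ ⟨b, rfl⟩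
    rcases h : σ (.inr b) with a | b'
    · exact absurd h (hcon b a)
    · exact ⟨b', rfl⟩
  obtain ⟨b, a, hba⟩ := hσ'
  -- Truncated subtraction of `t` annihilates `f` on the right summand and is exact on the left one.
  have hpos : 0 < ∑ b, (f (σ (.inr b)) - t) := by
    refine Finset.sum_pos' (fun _ _ => Nat.zero_le _) ⟨b, Finset.mem_univ _, ?_⟩
    rw [hba]
    exact Nat.sub_pos_of_lt (hl a)
  have hperm : ∑ x, (f (σ x) - t) = ∑ x, (f x - t) := Equiv.sum_comp σ fun x => f x - t
  rw [Fintype.sum_sum_type, Fintype.sum_sum_type] at hperm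
  have hzero : ∑ b, (f (.inr b) - t) = 0 :=
    Finset.sum_eq_zero fun b _ => Nat.sub_eq_zero_of_le (hr b)
  have h1 : ∑ a, f (σ (.inl a)) ≤ ∑ a, (t + (f (σ (.inl a)) - t)) :=
    Finset.sum_le_sum fun a _ => by omega
  have h2 : ∑ a, f (.inl a) = ∑ a, (t + (f (.inl a) - t)) :=
    Finset.sum_congr rfl fun a _ => by have := hl a; omega
  rw [Finset.sum_add_distrib] at h1 h2
  omega

section Pluecker

variable {B : Type*} [CommRing B] {m : ℕ} {J : Type*}

/-- The maximal minor, with column indices `c`, of the matrix whose `j`-th column is `v j`. -/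
def maxMinor (v : J → Fin m → B) (c : Fin m → J) : B :=
  Matrix.detRowAlternating fun i => v (c i)

theorem sum_dite_weight (P : Fin m → Prop) [DecidablePred P] (u : {i // P i} → J) (c : Fin m → J)
    (w : J → ℕ) :
    ∑ i, w (if h : P i then u ⟨i, h⟩ else c i) = ∑ i, w (u i) + ∑ i : {i // ¬ P i}, w (c i) := by
  rw [← Fintype.sum_subtype_add_sum_subtype P]
  congr 1
  · exact Finset.sum_congr rfl fun i _ => by simp [i.2]
  · exact Finset.sum_congr rfl fun i _ => by simp [i.2]

/-- Exchange relation: the `m + 1` vectors `v (d i)`, `i ≤ k`, and `v (c i)`, `k ≤ i`, are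
alternated; the resulting sum vanishes because they live in a module of rank `m`. -/
theorem maxMinor_mul_mem_span (K : Type*) [CommRing K] [Algebra K B] (v : J → Fin m → B)
    (w : J → ℕ) (c d : Fin m → J) (k : Fin m) (hc : ∀ i, k ≤ i → w (d k) < w (c i))
    (hd : ∀ i, i ≤ k → w (d i) ≤ w (d k)) :
    maxMinor v c * maxMinor v d ∈ Submodule.span K
      {x | ∃ c' d' : Fin m → J, ∑ i, w (c' i) < ∑ i, w (c i) ∧
        ∑ i, w (c' i) + ∑ i, w (d' i) = ∑ i, w (c i) + ∑ i, w (d i) ∧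
        x = maxMinor v c' * maxMinor v d'} := by
  classical
  let det : (Fin m → B) [⋀^Fin m]→ₗ[B] B := Matrix.detRowAlternating
  let a := fixArguments det (fun i => k ≤ i) (fun i => v (c i))
  let b := fixArguments det (fun i => i ≤ k) (fun i => v (d i))
  let u : {i // k ≤ i} ⊕ {i // i ≤ k} → J := Sum.elim (fun i => c i) (fun i => d i)
  let c' : Equiv.Perm ({i // k ≤ i} ⊕ {i // i ≤ k}) → Fin m → J := fun σ i =>
    if h : k ≤ i then u (σ (.inl ⟨i, h⟩)) else c i
  let d' : Equiv.Perm ({i // k ≤ i} ⊕ {i // i ≤ k}) → Fin m → J := fun σ i =>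
    if h : i ≤ k then u (σ (.inr ⟨i, h⟩)) else d i
  have hcard : Fintype.card (Fin m) < Fintype.card ({i // k ≤ i} ⊕ {i // i ≤ k}) := by
    rw [Fintype.card_sum, Fintype.card_subtype, Fintype.card_subtype]
    have h1 : (Finset.univ.filter fun i : Fin m => k ≤ i) = Finset.Ici k := by ext; simp
    have h2 : (Finset.univ.filter fun i : Fin m => i ≤ k) = Finset.Iic k := by ext; simp
    rw [h1, h2, Fin.card_Ici, Fin.card_Iic, Fintype.card_fin]
    omega
  have hzero := DFunLike.congr_fun
    (alternatingMap_eq_zero_of_card_lt hcard (a.domCoprod b)) (fun x => v (u x))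
  have hzero' := congrArg (LinearMap.mul' B B) hzero
  rw [AlternatingMap.domCoprod_apply, _root_.sum_apply, map_sum, AlternatingMap.zero_apply,
    map_zero] at hzero'
  -- `hzero'` is the exchange relation; its terms are indexed by the permutations modulo those that
  -- preserve the two summands, and the class of `1` gives the product being straightened.
  have hterm : ∀ σ : Equiv.Perm ({i // k ≤ i} ⊕ {i // i ≤ k}),
      LinearMap.mul' B B (AlternatingMap.domCoprod.summand a b (Quotient.mk'' σ)
        fun x => v (u x)) =
      Equiv.Perm.sign σ • (maxMinor v (c' σ) * maxMinor v (d' σ)) := by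
    intro σ
    have e1 : (fun i => if h : k ≤ i then v (u (σ (.inl ⟨i, h⟩))) else v (c i))
        = fun i => v (c' σ i) := by
      funext i; dsimp only [c']; split_ifs <;> rfl
    have e2 : (fun i => if h : i ≤ k then v (u (σ (.inr ⟨i, h⟩))) else v (d i))
        = fun i => v (d' σ i) := by
      funext i; dsimp only [d']; split_ifs <;> rfl
    rw [AlternatingMap.domCoprod.summand_mk'', maxMinor, maxMinor, ← e1, ← e2]
    rcases Int.units_eq_one_or (Equiv.Perm.sign σ) with hs | hs <;> rw [hs] <;>
      simp [MultilinearMap.domCoprod_apply, a, b, fixArguments_apply, det]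
  replace hzero' := (Finset.add_sum_erase _ _ (Finset.mem_univ (Quotient.mk'' 1 :
    Equiv.Perm.ModSumCongr {i // k ≤ i} {i // i ≤ k}))).trans hzero'
  have hone : LinearMap.mul' B B (AlternatingMap.domCoprod.summand a b (Quotient.mk'' 1)
        fun x => v (u x)) = maxMinor v c * maxMinor v d := by
    rw [hterm]
    have e1 : c' 1 = c := by funext i; simp [c', u]
    have e2 : d' 1 = d := by funext i; simp [d', u]
    simp [e1, e2]
  rw [hone] at hzero'
  rw [eq_neg_of_add_eq_zero_left hzero']
  refine Submodule.neg_mem _ (Submodule.sum_mem _ fun q hq => ?_)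
  induction q using Quotient.inductionOn' with | _ σ
  rw [hterm]
  have hσ : σ ∉ (Equiv.Perm.sumCongrHom {i // k ≤ i} {i // i ≤ k}).range := by
    intro h
    refine Finset.ne_of_mem_erase hq (Quotient.sound' ?_)
    rw [QuotientGroup.leftRel_apply]
    simpa using h
  have hmem : maxMinor v (c' σ) * maxMinor v (d' σ) ∈ Submodule.span K
      {x | ∃ c' d' : Fin m → J, ∑ i, w (c' i) < ∑ i, w (c i) ∧
        ∑ i, w (c' i) + ∑ i, w (d' i) = ∑ i, w (c i) + ∑ i, w (d i) ∧
        x = maxMinor v c' * maxMinor v d'} := by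
    refine Submodule.subset_span ⟨c' σ, d' σ, ?_⟩
    have hlt := sum_perm_inl_lt (fun x => w (u x)) (w (d k)) (fun i => hc i i.2)
      (fun i => hd i i.2) σ hσ
    have hperm := Equiv.sum_comp σ fun x => w (u x)
    rw [Fintype.sum_sum_type, Fintype.sum_sum_type] at hperm
    have hc' := sum_dite_weight (fun i => k ≤ i) (fun i => u (σ (.inl i))) c w
    have hd' := sum_dite_weight (fun i => i ≤ k) (fun i => u (σ (.inr i))) d w
    have hc0 := Fintype.sum_subtype_add_sum_subtype (fun i => k ≤ i) (fun i => w (c i))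
    have hd0 := Fintype.sum_subtype_add_sum_subtype (fun i => i ≤ k) (fun i => w (d i))
    simp only [u, Sum.elim_inl, Sum.elim_inr] at hlt hperm hc' hd'
    simp only [c', d', u]
    refine ⟨?_, ?_, trivial⟩ <;> omega
  rcases Int.units_eq_one_or (Equiv.Perm.sign σ) with hs | hs <;> rw [hs]
  · simpa using hmem
  · simpa using hmem

/-! ### Straightening of products of maximal minors -/

/-- Up to sign, a nonzero maximal minor has increasing column indices. -/
theorem maxMinor_eq_zero_or {N : ℕ} (v : Fin N → Fin m → B) (c : Fin m → Fin N) :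
    maxMinor v c = 0 ∨ ∃ c' : Fin m ↪o Fin N, ∑ i, (c' i : ℕ) = ∑ i, (c i : ℕ) ∧
      (maxMinor v c = maxMinor v c' ∨ maxMinor v c = -maxMinor v c') := by
  by_cases hc : Function.Injective c
  · right
    have hmono : StrictMono (c ∘ Tuple.sort c) :=
      (Tuple.monotone_sort c).strictMono_of_injective (hc.comp (Equiv.injective _))
    refine ⟨OrderEmbedding.ofStrictMono _ hmono, ?_, ?_⟩
    · exact Equiv.sum_comp (Tuple.sort c) fun i => (c i : ℕ)
    · have h := AlternatingMap.map_perm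
        (Matrix.detRowAlternating : (Fin m → B) [⋀^Fin m]→ₗ[B] B) (fun i => v (c i)) (Tuple.sort c)
      change maxMinor v (c ∘ Tuple.sort c) = _ • maxMinor v c at h
      change maxMinor v c = maxMinor v (c ∘ Tuple.sort c) ∨
        maxMinor v c = -maxMinor v (c ∘ Tuple.sort c)
      rw [h]
      rcases Int.units_eq_one_or (Equiv.Perm.sign (Tuple.sort c)) with hs | hs <;> rw [hs] <;> simp
  · left
    rw [Function.Injective] at hc
    push Not at hc
    obtain ⟨i, j, hij, hne⟩ := hc
    exact AlternatingMap.map_eq_zero_of_eq _ _ (by rw [hij]) hne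

/-- A product of two maximal minors that are not comparable in the given order is a combination
of products whose first factor has smaller weight, the total weight being the same. -/
theorem maxMinor_mul_mem_span_of_not_le (K : Type*) [CommRing K] [Algebra K B] {N : ℕ}
    (v : Fin N → Fin m → B) (c d : Fin m ↪o Fin N) (hcd : ¬ ∀ i, c i ≤ d i) :
    maxMinor v c * maxMinor v d ∈ Submodule.span K
      {x | ∃ c' d' : Fin m ↪o Fin N, ∑ i, (c' i : ℕ) < ∑ i, (c i : ℕ) ∧
        ∑ i, (c' i : ℕ) + ∑ i, (d' i : ℕ) = ∑ i, (c i : ℕ) + ∑ i, (d i : ℕ) ∧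
        x = maxMinor v c' * maxMinor v d'} := by
  push Not at hcd
  obtain ⟨k, hk⟩ := hcd
  refine Submodule.span_le.2 ?_ (maxMinor_mul_mem_span K v (fun j => (j : ℕ)) c d k
    (fun i hi => lt_of_lt_of_le hk (c.monotone hi)) (fun i hi => d.monotone hi))
  rintro _ ⟨c₁, d₁, hlt, hsum, rfl⟩
  rcases maxMinor_eq_zero_or v c₁ with h | ⟨c₂, hc₂, hc₂'⟩
  · simp [h]
  rcases maxMinor_eq_zero_or v d₁ with h | ⟨d₂, hd₂, hd₂'⟩
  · simp [h]
  have hmem : maxMinor v c₂ * maxMinor v d₂ ∈ Submodule.span K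
      {x | ∃ c' d' : Fin m ↪o Fin N, ∑ i, (c' i : ℕ) < ∑ i, (c i : ℕ) ∧
        ∑ i, (c' i : ℕ) + ∑ i, (d' i : ℕ) = ∑ i, (c i : ℕ) + ∑ i, (d i : ℕ) ∧
        x = maxMinor v c' * maxMinor v d'} :=
    Submodule.subset_span ⟨c₂, d₂, by omega, by omega, rfl⟩
  rcases hc₂' with h1 | h1 <;> rcases hd₂' with h2 | h2 <;> rw [h1, h2] <;> simpa using hmem

/-- The sum of the weights of all initial segments of `L`, the weight of `c` being the sum of its
entries. It drops when weight moves from a factor to the next one. -/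
def potential {N : ℕ} : List (Fin m ↪o Fin N) → ℕ
  | [] => 0
  | c :: L => (L.length + 1) * ∑ i, (c i : ℕ) + potential L

theorem potential_append_lt {N : ℕ} (L₁ L₂ : List (Fin m ↪o Fin N)) (c d c' d' : Fin m ↪o Fin N)
    (hlt : ∑ i, (c' i : ℕ) < ∑ i, (c i : ℕ))
    (hsum : ∑ i, (c' i : ℕ) + ∑ i, (d' i : ℕ) = ∑ i, (c i : ℕ) + ∑ i, (d i : ℕ)) :
    potential (L₁ ++ c' :: d' :: L₂) < potential (L₁ ++ c :: d :: L₂) := by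
  induction L₁ with
  | nil =>
    simp only [List.nil_append, potential, List.length_cons]
    nlinarith
  | cons e L₁ ih => simpa [potential] using ih

/-- Products of maximal minors are spanned by those with a chain of column indices. -/
theorem prod_maxMinor_mem_span_isChain (K : Type*) [CommRing K] [Algebra K B] {N : ℕ}
    (v : Fin N → Fin m → B) (L : List (Fin m ↪o Fin N)) :
    (L.map fun c : Fin m ↪o Fin N => maxMinor v c).prod ∈ Submodule.span K
      {x | ∃ L' : List (Fin m ↪o Fin N), L'.IsChain (fun c d => ∀ i, c i ≤ d i) ∧
        x = (L'.map fun c : Fin m ↪o Fin N => maxMinor v c).prod} := by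
  induction hn : potential L using Nat.strong_induction_on generalizing L with | _ p ih
  subst hn
  by_cases hL : L.IsChain (fun c d => ∀ i, c i ≤ d i)
  · exact Submodule.subset_span ⟨L, hL, rfl⟩
  · rw [List.isChain_iff_forall_rel_of_append_cons_cons] at hL
    push Not at hL
    obtain ⟨c, d, L₁, L₂, rfl, hcd⟩ := hL
    have hmem := maxMinor_mul_mem_span_of_not_le K v c d (by push Not; exact hcd)
    have hfac : ∀ c d : Fin m ↪o Fin N,
        ((L₁ ++ c :: d :: L₂).map fun c : Fin m ↪o Fin N => maxMinor v c).prod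
        = LinearMap.mulLeft K ((L₁.map fun c : Fin m ↪o Fin N => maxMinor v c).prod *
          (L₂.map fun c : Fin m ↪o Fin N => maxMinor v c).prod) (maxMinor v c * maxMinor v d) := by
      intro c d
      simp only [List.map_append, List.map_cons, List.prod_append, List.prod_cons,
        LinearMap.mulLeft_apply]
      ring
    rw [hfac]
    refine Submodule.span_le.2 ?_ (Submodule.apply_mem_span_image_of_mem_span _ hmem)
    rintro _ ⟨_, ⟨c', d', hlt, hsum, rfl⟩, rfl⟩
    rw [← hfac]
    exact ih _ (potential_append_lt L₁ L₂ c d c' d' hlt hsum) _ rfl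

end Pluecker

/-! ### Minors as maximal minors -/

/-- Comparison of the elements of two finite sets by counting elements below a bound. -/
theorem orderEmbOfFin_le_of_card_filter_le {N t u : ℕ} (S T : Finset (Fin N)) (hS : S.card = t)
    (hT : T.card = u)
    (h : ∀ y ≤ N, (T.filter fun j : Fin N => (j : ℕ) < y).card
      ≤ (S.filter fun j : Fin N => (j : ℕ) < y).card)
    (i : Fin t) (j : Fin u) (hij : (i : ℕ) = j) : S.orderEmbOfFin hS i ≤ T.orderEmbOfFin hT j := by
  by_contra hlt
  push Not at hlt
  -- Exactly `i` elements of `S` lie below its `i`-th element, but at least `i + 1` elements of `T`.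
  have hS' : (S.filter fun x : Fin N => (x : ℕ) < S.orderEmbOfFin hS i).card ≤ i := by
    have : (S.filter fun x : Fin N => (x : ℕ) < S.orderEmbOfFin hS i)
        ⊆ (Finset.Iio i).image (S.orderEmbOfFin hS) := by
      intro x hx
      rw [Finset.mem_filter] at hx
      have hx' : x ∈ Set.range (S.orderEmbOfFin hS) := by
        rw [Finset.range_orderEmbOfFin]; exact hx.1
      obtain ⟨l, rfl⟩ := hx'
      refine Finset.mem_image_of_mem _ (Finset.mem_Iio.2 ?_)
      exact (S.orderEmbOfFin hS).lt_iff_lt.1 hx.2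
    exact (Finset.card_le_card this).trans (Finset.card_image_le.trans (by simp))
  have hT' : (j : ℕ) + 1 ≤ (T.filter fun x : Fin N => (x : ℕ) < S.orderEmbOfFin hS i).card := by
    have : (Finset.Iic j).image (T.orderEmbOfFin hT)
        ⊆ (T.filter fun x : Fin N => (x : ℕ) < S.orderEmbOfFin hS i) := by
      intro x hx
      obtain ⟨l, hl, rfl⟩ := Finset.mem_image.1 hx
      refine Finset.mem_filter.2 ⟨Finset.orderEmbOfFin_mem _ _ _, ?_⟩
      exact lt_of_le_of_lt ((T.orderEmbOfFin hT).monotone (Finset.mem_Iic.1 hl)) hlt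
    have h2 := Finset.card_le_card this
    rwa [Finset.card_image_of_injective _ (T.orderEmbOfFin hT).injective, Fin.card_Iic] at h2
  have := h (S.orderEmbOfFin hS i) (S.orderEmbOfFin hS i).2.le
  omega

section Translation

variable {m n : ℕ}

/-- The columns of the `m × n` block chosen by `c`, in an `m × (n + m)` matrix. -/
def colSet (c : Fin m ↪o Fin (n + m)) : Finset (Fin n) :=
  Finset.univ.filter fun j => ∃ i, c i = Fin.castAdd m j

/-- The rows that remain after deleting, for each chosen column `n + k`, the row `m - 1 - k`,
in which the `k`-th column of the antidiagonal unit matrix has its nonzero entry. -/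
def rowSet (c : Fin m ↪o Fin (n + m)) : Finset (Fin m) :=
  Finset.univ.filter fun l => ¬ ∃ i, c i = Fin.natAdd n l.rev

/-- Column indices below a bound are counted by the indices of `c` below the same bound. -/
theorem card_colSet_filter (c : Fin m ↪o Fin (n + m)) {y : ℕ} (hy : y ≤ n) :
    ((colSet c).filter fun j : Fin n => (j : ℕ) < y).card
      = (Finset.univ.filter fun i => (c i : ℕ) < y).card := by
  rw [← Finset.card_map (Fin.castAddEmb m), ← Finset.card_map c.toEmbedding]
  congr 1
  ext x
  simp only [Finset.mem_map, Finset.mem_filter, colSet, Finset.mem_univ, true_and]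
  constructor
  · rintro ⟨j, ⟨⟨i, hi⟩, hj⟩, rfl⟩
    exact ⟨i, by rw [hi]; simpa using hj, hi⟩
  · rintro ⟨i, hi, rfl⟩
    exact ⟨⟨c i, by omega⟩, ⟨⟨i, Fin.ext rfl⟩, hi⟩, Fin.ext rfl⟩

/-- Row indices below a bound are counted by the indices of `c` below the reflected bound. -/
theorem card_rowSet_filter (c : Fin m ↪o Fin (n + m)) {x : ℕ} (hx : x ≤ m) :
    ((rowSet c).filter fun l : Fin m => (l : ℕ) < x).card + m
      = x + (Finset.univ.filter fun i => (c i : ℕ) < n + m - x).card := by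
  have h1 : ((rowSet c).filter fun l : Fin m => (l : ℕ) < x).card
      + ((rowSet c)ᶜ.filter fun l : Fin m => (l : ℕ) < x).card = x := by
    rw [← Finset.card_union_of_disjoint, ← Finset.filter_union, Finset.union_compl,
      Fin.card_filter_val_lt, min_eq_right hx]
    exact Finset.disjoint_filter_filter disjoint_compl_right
  have h2 : ((rowSet c)ᶜ.filter fun l : Fin m => (l : ℕ) < x).card
      = (Finset.univ.filter fun i => ¬ (c i : ℕ) < n + m - x).card := by
    rw [← Finset.card_map (Fin.revPerm.toEmbedding.trans (Fin.natAddEmb n)),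
      ← Finset.card_map c.toEmbedding]
    congr 1
    ext z
    simp only [Finset.mem_map, Finset.mem_filter, rowSet, Finset.mem_univ, true_and,
      Finset.mem_compl, not_not]
    constructor
    · rintro ⟨l, ⟨⟨i, hi⟩, hl⟩, rfl⟩
      refine ⟨i, ?_, hi⟩
      rw [hi, Fin.val_natAdd, Fin.val_rev]
      omega
    · rintro ⟨i, hi, rfl⟩
      have hlt := (c i).2
      have key : Fin.natAdd n (Fin.rev ⟨n + m - 1 - c i, by omega⟩) = c i := by
        refine Fin.ext ?_
        rw [Fin.val_natAdd, Fin.val_rev]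
        simp only
        omega
      exact ⟨⟨n + m - 1 - c i, by omega⟩, ⟨⟨i, key.symm⟩, by simp only; omega⟩, key⟩
  have h3 := Finset.card_filter_add_card_filter_not (s := (Finset.univ : Finset (Fin m)))
    (fun i => (c i : ℕ) < n + m - x)
  rw [Finset.card_univ, Fintype.card_fin] at h3
  omega

theorem card_colSet (c : Fin m ↪o Fin (n + m)) :
    (colSet c).card = (Finset.univ.filter fun i => (c i : ℕ) < n).card := by
  rw [← card_colSet_filter c le_rfl, Finset.filter_true_of_mem fun j _ => j.2]

theorem card_rowSet (c : Fin m ↪o Fin (n + m)) : (rowSet c).card = (colSet c).card := by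
  have h := card_rowSet_filter c le_rfl
  rw [Finset.filter_true_of_mem fun j _ => j.2, Nat.add_sub_cancel, ← card_colSet] at h
  omega

theorem card_filter_lt_le {N : ℕ} {c d : Fin m ↪o Fin N} (h : ∀ i, c i ≤ d i) (y : ℕ) :
    (Finset.univ.filter fun i => (d i : ℕ) < y).card
      ≤ (Finset.univ.filter fun i => (c i : ℕ) < y).card := by
  refine Finset.card_le_card fun i hi => ?_
  simp only [Finset.mem_filter, Finset.mem_univ, true_and] at hi ⊢
  have := h i
  omega

/-- The minor of the `m × n` block corresponding to a maximal minor of the matrix obtained by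
appending the antidiagonal unit matrix; `none` if no column of the block is involved. -/
def toMinor (c : Fin m ↪o Fin (n + m)) : Option (Minor m n) :=
  if h : 0 < (colSet c).card then
    some ⟨_, h, (rowSet c).orderEmbOfFin (card_rowSet c), (colSet c).orderEmbOfFin rfl⟩
  else none

/-- The passage from maximal minors to minors is monotone: both orders are comparisons of the
number of indices below a bound. -/
theorem toMinor_le {c d : Fin m ↪o Fin (n + m)} (hcd : ∀ i, c i ≤ d i) (δ : Minor m n)
    (hδ : toMinor c = some δ) (ε : Minor m n) (hε : toMinor d = some ε) : δ.Le ε := by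
  unfold toMinor at hδ hε
  split_ifs at hδ with hc
  split_ifs at hε with hd
  obtain rfl := Option.some.inj hδ
  obtain rfl := Option.some.inj hε
  have hle : (colSet d).card ≤ (colSet c).card := by
    rw [card_colSet, card_colSet]; exact card_filter_lt_le hcd n
  refine ⟨hle, fun i => ⟨?_, ?_⟩⟩
  · refine orderEmbOfFin_le_of_card_filter_le _ _ _ _ (fun y hy => ?_) _ _ rfl
    have h1 := card_rowSet_filter c hy
    have h2 := card_rowSet_filter d hy
    have h3 := card_filter_lt_le hcd (n + m - y)
    omega
  · refine orderEmbOfFin_le_of_card_filter_le _ _ _ _ (fun y hy => ?_) _ _ rfl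
    rw [card_colSet_filter c hy, card_colSet_filter d hy]
    exact card_filter_lt_le hcd y

variable {B : Type*} [CommRing B]

/-- The columns of the matrix `A` followed by those of the antidiagonal unit matrix. -/
def extendedCols (A : Matrix (Fin m) (Fin n) B) : Fin (n + m) → Fin m → B :=
  Fin.append (fun j i => A i j) fun k => Pi.single k.rev 1

/-- Expansion of a maximal minor of the extended matrix along the unit columns. -/
theorem maxMinor_extendedCols (A : Matrix (Fin m) (Fin n) B) (c : Fin m ↪o Fin (n + m)) :
    maxMinor (extendedCols A) c = (A.submatrix ((rowSet c).orderEmbOfFin (card_rowSet c))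
        ((colSet c).orderEmbOfFin rfl)).det ∨
      maxMinor (extendedCols A) c = -(A.submatrix ((rowSet c).orderEmbOfFin (card_rowSet c))
        ((colSet c).orderEmbOfFin rfl)).det := by
  set row := (rowSet c).orderEmbOfFin (card_rowSet c) with hrow
  set col := (colSet c).orderEmbOfFin rfl with hcol
  -- Listing the rows as `rowSet c` followed by its complement, and the columns accordingly, makes
  -- the (transposed) matrix block triangular with a unit block.
  let eR : Fin (colSet c).card ⊕ {l // ¬ l ∈ rowSet c} ≃ Fin m :=
    (((rowSet c).orderIsoOfFin (card_rowSet c)).toEquiv.sumCongr (Equiv.refl _)).trans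
      (Equiv.sumCompl fun l => l ∈ rowSet c)
  have hcolmem : ∀ i, ∃ k, c k = Fin.castAdd m (col i) := fun i => by
    have := Finset.orderEmbOfFin_mem (colSet c) rfl i
    exact (Finset.mem_filter.1 this).2
  have hrowmem : ∀ l : {l // ¬ l ∈ rowSet c}, ∃ k, c k = Fin.natAdd n l.1.rev := fun l => by
    have := l.2
    simpa only [rowSet, Finset.mem_filter, Finset.mem_univ, true_and, not_not] using this
  choose f hf using hcolmem
  choose g hg using hrowmem
  have hinj : Function.Injective (Sum.elim f g) := by
    rintro (i | l) (i' | l') h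
    · have := congrArg c h
      simp only [Sum.elim_inl, hf] at this
      rw [col.injective (Fin.castAdd_injective n m this)]
    · have := congrArg (fun k => (c k : ℕ)) h
      simp only [Sum.elim_inl, Sum.elim_inr, hf, hg, Fin.val_castAdd, Fin.val_natAdd] at this
      omega
    · have := congrArg (fun k => (c k : ℕ)) h
      simp only [Sum.elim_inl, Sum.elim_inr, hf, hg, Fin.val_castAdd, Fin.val_natAdd] at this
      omega
    · have := congrArg c h
      simp only [Sum.elim_inr, hg] at this
      rw [Subtype.ext (Fin.rev_injective (Fin.natAdd_injective m n this))]
  let eC := Equiv.ofBijective (Sum.elim f g)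
    ((Fintype.bijective_iff_injective_and_card _).2 ⟨hinj, Fintype.card_congr eR⟩)
  let N : Matrix (Fin m) (Fin m) B := fun i => extendedCols A (c i)
  have hblock : N.submatrix eC eR = Matrix.fromBlocks (A.submatrix row col).transpose
      (Matrix.of fun i l => A l.1 (col i)) 0 1 := by
    ext (i | l) (i' | l')
    · change extendedCols A (c (f i)) (row i') = A (row i') (col i)
      rw [hf, extendedCols, Fin.append_left]
    · change extendedCols A (c (f i)) l'.1 = A l'.1 (col i)
      rw [hf, extendedCols, Fin.append_left]
    · change extendedCols A (c (g l)) (row i') = 0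
      rw [hg, extendedCols, Fin.append_right, Fin.rev_rev, Pi.single_apply, if_neg]
      intro h
      exact l.2 (h ▸ Finset.orderEmbOfFin_mem _ _ _)
    · change extendedCols A (c (g l)) l'.1 = (1 : Matrix _ _ B) l l'
      rw [hg, extendedCols, Fin.append_right, Fin.rev_rev, Pi.single_apply, Matrix.one_apply]
      simp only [Subtype.ext_iff, eq_comm]
  have hdet : (N.submatrix eC eR).det = (A.submatrix row col).det := by
    rw [hblock, Matrix.det_fromBlocks_zero₂₁, Matrix.det_transpose, Matrix.det_one, mul_one]
  have hperm : N.submatrix eC eR = (N.submatrix (eR.symm.trans eC) id).submatrix eR eR := by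
    ext i j; simp
  rw [hperm, Matrix.det_submatrix_equiv_self, Matrix.det_permute] at hdet
  rw [← hdet]
  change N.det = _ ∨ N.det = _
  rcases Int.units_eq_one_or (Equiv.Perm.sign (eR.symm.trans eC)) with hs | hs <;> rw [hs] <;> simp

theorem prod_maxMinor_extendedCols (A : Matrix (Fin m) (Fin n) B)
    (L : List (Fin m ↪o Fin (n + m))) :
    (L.map fun c : Fin m ↪o Fin (n + m) => maxMinor (extendedCols A) c).prod
        = ((L.filterMap toMinor).map fun δ => δ.value A).prod ∨
      (L.map fun c : Fin m ↪o Fin (n + m) => maxMinor (extendedCols A) c).prod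
        = -((L.filterMap toMinor).map fun δ => δ.value A).prod := by
  induction L with
  | nil => simp
  | cons c L ih =>
    have hc := maxMinor_extendedCols A c
    rw [List.map_cons, List.prod_cons]
    by_cases h : 0 < (colSet c).card
    · have hsome : toMinor c = some ⟨_, h, (rowSet c).orderEmbOfFin (card_rowSet c),
        (colSet c).orderEmbOfFin rfl⟩ := dif_pos h
      rw [List.filterMap_cons_some hsome, List.map_cons, List.prod_cons, Minor.value]
      rcases hc with hc | hc <;> rcases ih with ih | ih <;> rw [hc, ih] <;> simp
    · have hnone : toMinor c = none := dif_neg h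
      have hempty : IsEmpty (Fin (colSet c).card) := by
        rw [Nat.eq_zero_of_not_pos h]; infer_instance
      rw [Matrix.det_isEmpty] at hc
      rw [List.filterMap_cons_none hnone]
      rcases hc with hc | hc <;> rcases ih with ih | ih <;> rw [hc, ih] <;> simp

/-- The entry `(i, j)` is obtained from the `j`-th column and all unit columns but the `i`-th. -/
theorem maxMinor_extendedCols_entry (A : Matrix (Fin m) (Fin n) B) (i : Fin m) (j : Fin n) :
    maxMinor (extendedCols A)
      (fun l => if l = i then Fin.castAdd m j else Fin.natAdd n l.rev) = A i j := by
  have h : (fun l => extendedCols A (if l = i then Fin.castAdd m j else Fin.natAdd n l.rev))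
      = (1 : Matrix (Fin m) (Fin m) B).updateRow i fun l => A l j := by
    ext l k
    by_cases hl : l = i
    · subst hl
      simp [extendedCols, Fin.append_left]
    · rw [if_neg hl, Matrix.updateRow_ne hl, extendedCols, Fin.append_right, Fin.rev_rev,
        Pi.single_apply, Matrix.one_apply]
      simp only [eq_comm]
  change Matrix.det _ = _
  rw [h, ← Matrix.cramer_transpose_apply, Matrix.transpose_one, Matrix.cramer_one]
  rfl

/-! ### Standard bitableaux span -/

instance : Trans (Minor.Le (m := m) (n := n)) (Minor.Le (m := m) (n := n))
    (Minor.Le (m := m) (n := n)) where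
  trans := fun {_ _ _} ⟨h, h'⟩ ⟨k, k'⟩ => ⟨k.trans h, fun i =>
    ⟨(h' (Fin.castLE k i)).1.trans (k' i).1, (h' (Fin.castLE k i)).2.trans (k' i).2⟩⟩

/-- Straightening: the standard products of minors span the polynomial ring. -/
theorem span_standard_eq_top (K : Type*) [Field K] (m n : ℕ) :
    Submodule.span K {x | ∃ L : List (Minor m n), IsStandard L ∧
      x = (L.map fun δ => δ.value (Matrix.mvPolynomialX (Fin m) (Fin n) K)).prod} = ⊤ := by
  set A := Matrix.mvPolynomialX (Fin m) (Fin n) K with hA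
  let p : (Fin m ↪o Fin (n + m)) → MvPolynomial (Fin m × Fin n) K := fun c =>
    maxMinor (extendedCols A) c
  have hadj : Algebra.adjoin K (Set.range p) = ⊤ := by
    rw [eq_top_iff, ← MvPolynomial.adjoin_range_X]
    refine Algebra.adjoin_le ?_
    rintro _ ⟨⟨i, j⟩, rfl⟩
    have hX : (MvPolynomial.X (i, j) : MvPolynomial (Fin m × Fin n) K) = A i j := by
      rw [hA, Matrix.mvPolynomialX_apply]
    rw [hX, ← maxMinor_extendedCols_entry A i j]
    rcases maxMinor_eq_zero_or (extendedCols A)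
      (fun l => if l = i then Fin.castAdd m j else Fin.natAdd n l.rev) with h | ⟨c, -, h | h⟩
    · rw [h]; exact zero_mem _
    · rw [h]; exact Algebra.subset_adjoin ⟨c, rfl⟩
    · rw [h]; exact neg_mem (Algebra.subset_adjoin ⟨c, rfl⟩)
  rw [eq_top_iff, ← Algebra.top_toSubmodule, ← hadj, Algebra.adjoin_eq_span]
  refine Submodule.span_le.2 fun x hx => ?_
  obtain ⟨l, hl, rfl⟩ := Submonoid.exists_list_of_mem_closure hx
  have hl' : l ∈ Set.range (List.map p) := by rw [Set.range_list_map]; exact hl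
  obtain ⟨L, rfl⟩ := hl'
  refine Submodule.span_le.2 ?_ (prod_maxMinor_mem_span_isChain K (extendedCols A) L)
  rintro _ ⟨L', hL', rfl⟩
  have : Trans (fun c d : Fin m ↪o Fin (n + m) => ∀ i, c i ≤ d i)
      (fun c d : Fin m ↪o Fin (n + m) => ∀ i, c i ≤ d i)
      (fun c d : Fin m ↪o Fin (n + m) => ∀ i, c i ≤ d i) :=
    ⟨fun h h' i => (h i).trans (h' i)⟩
  have hstd : IsStandard (L'.filterMap toMinor) :=
    ((List.isChain_iff_pairwise.1 hL').filterMap toMinor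
      fun c d hcd δ hδ ε hε => toMinor_le hcd δ hδ ε hε).isChain
  have hmem := Submodule.subset_span (R := K) (s := {x | ∃ L : List (Minor m n), IsStandard L ∧
      x = (L.map fun δ => δ.value A).prod}) ⟨_, hstd, rfl⟩
  rcases prod_maxMinor_extendedCols A L' with h | h <;> rw [h]
  · exact hmem
  · exact Submodule.neg_mem _ hmem

end Translation

/-! ### Leading monomials of minors of `YZ` -/

section LeadingMonomials

open scoped MonomialOrder

/-- Polynomials that are monic for a monomial order and have pairwise distinct leading exponents
are linearly independent. -/
theorem linearIndependent_of_degree_injective {σ ι K : Type*} [Field K] (ord : MonomialOrder σ)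
    (p : ι → MvPolynomial σ K) (hmonic : ∀ i, ord.Monic (p i))
    (hinj : Function.Injective fun i => ord.degree (p i)) : LinearIndependent K p := by
  classical
  rw [linearIndependent_iff']
  intro s g hg i hi
  by_contra hgi
  obtain ⟨j, hj, hmax⟩ := (s.filter fun i => g i ≠ 0).exists_max_image
    (fun i => ord.toSyn (ord.degree (p i))) ⟨i, Finset.mem_filter.2 ⟨hi, hgi⟩⟩
  rw [Finset.mem_filter] at hj
  have hcoeff := congrArg (MvPolynomial.coeff (ord.degree (p j))) hg
  rw [MvPolynomial.coeff_sum, MvPolynomial.coeff_zero, Finset.sum_eq_single j] at hcoeff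
  · rw [MvPolynomial.coeff_smul, (hmonic j).coeff_degree] at hcoeff
    exact hj.2 (by simpa using hcoeff)
  · intro l hl hlj
    rw [MvPolynomial.coeff_smul]
    by_cases hgl : g l = 0
    · simp [hgl]
    · rw [ord.coeff_eq_zero_of_lt, smul_zero]
      refine lt_of_le_of_ne (hmax l (Finset.mem_filter.2 ⟨hl, hgl⟩)) fun h => hlj (hinj ?_)
      exact ord.toSyn.injective h
  · exact fun h => absurd hj.1 h

/-- The first place where an injective map of an initial segment differs from the inclusion. -/
theorem exists_first_difference {α : Type*} [LinearOrder α] {t r : ℕ} (a : Fin t → α)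
    (ha : StrictMono a) (h : t ≤ r) (f : Fin t → Fin r) (hf : Function.Injective f)
    (hne : f ≠ Fin.castLE h) :
    ∃ i, (∀ p : α × Fin r, toLex p < toLex (a i, Fin.castLE h i) →
        ∀ l, (a l, f l) = p ↔ (a l, Fin.castLE h l) = p) ∧
      ∀ l, (a l, f l) ≠ (a i, Fin.castLE h i) := by
  obtain ⟨i, hi, hmin⟩ : ∃ i, f i ≠ Fin.castLE h i ∧ ∀ l < i, f l = Fin.castLE h l := by
    obtain ⟨i₀, hi₀⟩ := Function.ne_iff.1 hne
    obtain ⟨i, hi, hmin⟩ := WellFounded.has_min (wellFounded_lt (α := Fin t))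
      {i | f i ≠ Fin.castLE h i} ⟨i₀, hi₀⟩
    exact ⟨i, hi, fun l hl => by_contra fun hne => hmin l hne hl⟩
  refine ⟨i, fun p hp l => ?_, fun l hl => ?_⟩
  · rcases lt_or_ge l i with hl | hl
    · rw [hmin l hl]
    · -- Both sides fail: the row forces `l = i`, and smaller values of `f` are already taken.
      have key : ∀ k : Fin r, (∀ l' < i, k ≠ f l') → (a l, k) ≠ p := by
        rintro k hk rfl
        rw [Prod.Lex.toLex_lt_toLex] at hp
        rcases hp with hp | ⟨hp, hp'⟩
        · exact absurd (ha.monotone hl) (not_le.2 hp)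
        · have hki : (k : ℕ) < i := hp'
          refine hk ⟨k, hki.trans i.2⟩ hki ?_
          rw [hmin _ hki]
          exact Fin.ext rfl
      have h1 : (a l, f l) ≠ p := key _ fun l' hl' e => by
        have := hf e
        exact absurd (this ▸ hl') (not_lt.2 hl)
      have h2 : (a l, Fin.castLE h l) ≠ p := key _ fun l' hl' e => by
        rw [hmin l' hl'] at e
        have := Fin.castLE_injective h e
        exact absurd (this ▸ hl') (not_lt.2 hl)
      exact iff_of_false h1 h2
  · rw [Prod.mk.injEq] at hl
    obtain rfl := ha.injective hl.1
    exact hi hl.2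

/-- The lexicographic monomial order for the order of the indeterminates given by an injective
key; a smaller key means a larger indeterminate. -/
def lexOfKey {σ τ : Type*} [Finite σ] [LinearOrder τ] (key : σ → τ)
    (hkey : Function.Injective key) : MonomialOrder σ :=
  letI := LinearOrder.lift' key hkey
  MonomialOrder.lex

theorem lexOfKey_lt {σ τ : Type*} [Finite σ] [LinearOrder τ] (key : σ → τ)
    (hkey : Function.Injective key) {c d : σ →₀ ℕ} (s : σ)
    (h : ∀ s', key s' < key s → c s' = d s') (hs : c s < d s) : c ≺[lexOfKey key hkey] d := by
  let _ := LinearOrder.lift' key hkey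
  exact Finsupp.Lex.lt_iff.2 ⟨s, h, hs⟩

variable {m n r : ℕ}

/-- The position of an indeterminate in the lexicographic order: the entries of `Y` row by row,
then the entries of `Z` column by column. -/
def yzKey (m n r : ℕ) (s : (Fin m × Fin r) ⊕ (Fin r × Fin n)) :
    (Fin m ×ₗ Fin r) ⊕ₗ (Fin n ×ₗ Fin r) :=
  toLex (Sum.map (fun p => toLex p) (fun p => toLex p.swap) s)

theorem yzKey_injective (m n r : ℕ) : Function.Injective (yzKey m n r) :=
  toLex.injective.comp (Sum.map_injective.2
    ⟨toLex.injective, toLex.injective.comp Prod.swap_injective⟩)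

/-- The lexicographic monomial order on `K[Y, Z]` in which indeterminates with smaller `yzKey` are
larger. -/
def yzOrder (m n r : ℕ) : MonomialOrder ((Fin m × Fin r) ⊕ (Fin r × Fin n)) :=
  lexOfKey (yzKey m n r) (yzKey_injective m n r)

theorem yzOrder_lt {c d : (Fin m × Fin r) ⊕ (Fin r × Fin n) →₀ ℕ}
    (s : (Fin m × Fin r) ⊕ (Fin r × Fin n))
    (h : ∀ s', yzKey m n r s' < yzKey m n r s → c s' = d s') (hs : c s < d s) :
    c ≺[yzOrder m n r] d :=
  lexOfKey_lt _ _ s h hs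

/-- The exponent of `∏ Y_{a_i, f(i)} Z_{g(i), b_i}`. -/
def yzExp {t : ℕ} (a : Fin t → Fin m) (f g : Fin t → Fin r) (b : Fin t → Fin n) :
    (Fin m × Fin r) ⊕ (Fin r × Fin n) →₀ ℕ :=
  ∑ i, Finsupp.single (.inl (a i, f i)) 1 + ∑ i, Finsupp.single (.inr (g i, b i)) 1

theorem yzExp_inl {t : ℕ} (a : Fin t → Fin m) (f g : Fin t → Fin r) (b : Fin t → Fin n)
    (p : Fin m × Fin r) :
    yzExp a f g b (.inl p) = ∑ i, if (a i, f i) = p then 1 else 0 := by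
  simp [yzExp, Finsupp.single_apply]

theorem yzExp_inr {t : ℕ} (a : Fin t → Fin m) (f g : Fin t → Fin r) (b : Fin t → Fin n)
    (p : Fin r × Fin n) :
    yzExp a f g b (.inr p) = ∑ i, if (g i, b i) = p then 1 else 0 := by
  simp [yzExp, Finsupp.single_apply]

/-- Among the exponents `yzExp a f g b` with `f`, `g` injective, the largest one is that with
`f(i) = g(i) = i`. -/
theorem yzExp_lt {t : ℕ} (h : t ≤ r) (a : Fin t → Fin m) (ha : StrictMono a) (b : Fin t → Fin n)
    (hb : StrictMono b) (f g : Fin t → Fin r) (hf : Function.Injective f)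
    (hg : Function.Injective g) (hne : ¬ (f = Fin.castLE h ∧ g = Fin.castLE h)) :
    yzExp a f g b ≺[yzOrder m n r] yzExp a (Fin.castLE h) (Fin.castLE h) b := by
  by_cases hf' : f = Fin.castLE h
  · have hg' : g ≠ Fin.castLE h := fun hg' => hne ⟨hf', hg'⟩
    obtain ⟨i, hi, hi'⟩ := exists_first_difference b hb h g hg hg'
    refine yzOrder_lt (.inr (Fin.castLE h i, b i)) ?_ ?_
    · rintro (p | p) hp
      · rw [yzExp_inl, yzExp_inl, hf']
      · rw [yzExp_inr, yzExp_inr]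
        have hp' : toLex p.swap < toLex (b i, Fin.castLE h i) := Sum.Lex.inr_lt_inr_iff.1 hp
        refine Finset.sum_congr rfl fun l _ => if_congr ?_ rfl rfl
        have := hi _ hp' l
        simpa only [Prod.ext_iff, Prod.fst_swap, Prod.snd_swap, and_comm] using this
    · rw [yzExp_inr, yzExp_inr]
      rw [Finset.sum_eq_zero fun l _ => if_neg fun e => hi' l (congrArg Prod.swap e)]
      exact Finset.sum_pos' (fun _ _ => Nat.zero_le _) ⟨i, Finset.mem_univ _, by simp⟩
  · obtain ⟨i, hi, hi'⟩ := exists_first_difference a ha h f hf hf'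
    refine yzOrder_lt (.inl (a i, Fin.castLE h i)) ?_ ?_
    · rintro (p | p) hp
      · rw [yzExp_inl, yzExp_inl]
        have hp' : toLex p < toLex (a i, Fin.castLE h i) := Sum.Lex.inl_lt_inl_iff.1 hp
        exact Finset.sum_congr rfl fun l _ => if_congr (hi _ hp' l) rfl rfl
      · exact absurd hp Sum.Lex.not_inr_lt_inl
    · rw [yzExp_inl, yzExp_inl]
      rw [Finset.sum_eq_zero fun l _ => if_neg (hi' l)]
      exact Finset.sum_pos' (fun _ _ => Nat.zero_le _) ⟨i, Finset.mem_univ _, by simp⟩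

/-- Cauchy-Binet expansion, summed over all maps rather than over subsets. -/
theorem det_mul_eq_sum {B : Type*} [CommRing B] {t r : ℕ} (P : Matrix (Fin t) (Fin r) B)
    (Q : Matrix (Fin r) (Fin t) B) :
    (P * Q).det = ∑ f : Fin t → Fin r, (∏ i, P i (f i)) * (Q.submatrix f id).det := by
  have h : P * Q = fun i => ∑ k, P i k • Q k := by
    ext i j
    rw [Matrix.mul_apply, Finset.sum_apply]
    rfl
  have h1 := (Matrix.detRowAlternating : (Fin t → B) [⋀^Fin t]→ₗ[B] B).toMultilinearMap.map_sum
    (fun i k => P i k • Q k)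
  rw [h]
  refine h1.trans (Finset.sum_congr rfl fun f _ => ?_)
  exact (Matrix.detRowAlternating : (Fin t → B) [⋀^Fin t]→ₗ[B] B).toMultilinearMap.map_smul_univ
    (fun i => P i (f i)) (fun i => Q (f i))

variable (K : Type*) [Field K]

/-- Expansion of a minor of `YZ` into monomials. The terms with `f` not injective cancel. -/
theorem value_matYZ_eq_sum (δ : Minor m n) :
    δ.value (matYZ K m n r) =
      ∑ f : Fin δ.size → Fin r, ∑ σ : Equiv.Perm (Fin δ.size),
        if Function.Injective f then Equiv.Perm.sign σ •
          MvPolynomial.monomial (yzExp δ.rows f (f ∘ σ) δ.cols) (1 : K) else 0 := by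
  have h : (matYZ K m n r).submatrix δ.rows δ.cols
      = (matY K m n r).submatrix δ.rows id * (matZ K m n r).submatrix id δ.cols := by
    ext i j : 2
    simp [matYZ, Matrix.mul_apply]
  rw [Minor.value, h, det_mul_eq_sum]
  refine Finset.sum_congr rfl fun f _ => ?_
  by_cases hf : Function.Injective f
  · simp only [if_pos hf]
    rw [Matrix.det_apply, Finset.mul_sum]
    refine Finset.sum_congr rfl fun σ _ => ?_
    rw [mul_smul_comm, yzExp]
    congr 1
    rw [show (1 : K) = 1 * 1 from (one_mul 1).symm, ← MvPolynomial.monomial_mul,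
      MvPolynomial.monomial_sum_one, MvPolynomial.monomial_sum_one]
    rfl
  · simp only [if_neg hf, Finset.sum_const_zero]
    rw [Function.Injective] at hf
    push Not at hf
    obtain ⟨i, j, hij, hne⟩ := hf
    rw [Matrix.det_zero_of_row_eq hne, mul_zero]
    funext k
    simp [hij]

/-- The leading exponent of a minor of size at most `r` of `YZ`, that of
`∏ Y_{a_i, i} Z_{i, b_i}`; zero, by convention, for larger minors. -/
def leadExp (r : ℕ) (δ : Minor m n) : (Fin m × Fin r) ⊕ (Fin r × Fin n) →₀ ℕ :=
  if h : δ.size ≤ r then yzExp δ.rows (Fin.castLE h) (Fin.castLE h) δ.cols else 0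

theorem leadExp_inl {δ : Minor m n} (h : δ.size ≤ r) (p : Fin m × Fin r) :
    leadExp r δ (.inl p) ≠ 0 ↔ ∃ i : Fin δ.size, δ.rows i = p.1 ∧ (i : ℕ) = p.2 := by
  rw [leadExp, dif_pos h, yzExp_inl, Ne, Finset.sum_eq_zero_iff]
  push Not
  simp [Prod.ext_iff, Fin.ext_iff]

theorem leadExp_inr {δ : Minor m n} (h : δ.size ≤ r) (p : Fin r × Fin n) :
    leadExp r δ (.inr p) ≠ 0 ↔ ∃ i : Fin δ.size, δ.cols i = p.2 ∧ (i : ℕ) = p.1 := by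
  rw [leadExp, dif_pos h, yzExp_inr, Ne, Finset.sum_eq_zero_iff]
  push Not
  simp [Prod.ext_iff, Fin.ext_iff, and_comm]

/-- Only the identity term of the Cauchy-Binet expansion reaches the leading exponent. -/
theorem value_matYZ_monic (δ : Minor m n) (hδ : δ.size ≤ r) :
    (yzOrder m n r).Monic (δ.value (matYZ K m n r)) ∧
      (yzOrder m n r).degree (δ.value (matYZ K m n r)) = leadExp r δ := by
  classical
  set e := leadExp r δ with he
  have hpos : 0 ≺[yzOrder m n r] e := by
    rw [map_zero, (yzOrder m n r).toSyn_lt_iff_ne_zero, Ne, map_eq_zero_iff _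
      (yzOrder m n r).toSyn.injective]
    intro h0
    refine (leadExp_inl hδ (δ.rows ⟨0, δ.size_pos⟩, ⟨0, δ.size_pos.trans_le hδ⟩)).2
      ⟨⟨0, δ.size_pos⟩, rfl, rfl⟩ ?_
    rw [← he, h0, Finsupp.zero_apply]
  obtain ⟨q, hq, hval⟩ : ∃ q : PolyYZ K m n r, (∀ c ∈ q.support, c ≺[yzOrder m n r] e) ∧
      δ.value (matYZ K m n r) = MvPolynomial.monomial e 1 + q := by
    let F : (Fin δ.size → Fin r) × Equiv.Perm (Fin δ.size) → PolyYZ K m n r := fun x =>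
      if Function.Injective x.1 then Equiv.Perm.sign x.2 •
          MvPolynomial.monomial (yzExp δ.rows x.1 (x.1 ∘ x.2) δ.cols) (1 : K) else 0
    refine ⟨∑ x ∈ Finset.univ.erase (Fin.castLE hδ, 1), F x, fun c hc => ?_, ?_⟩
    · obtain ⟨⟨f, σ⟩, hx, hc'⟩ := Finset.mem_biUnion.1 (MvPolynomial.support_sum hc)
      simp only [F] at hc'
      split_ifs at hc' with hf
      · have hc'' : c = yzExp δ.rows f (f ∘ σ) δ.cols := by
          by_contra hne
          rw [MvPolynomial.mem_support_iff] at hc'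
          rcases Int.units_eq_one_or (Equiv.Perm.sign σ) with hs | hs <;> rw [hs] at hc' <;>
            simp [MvPolynomial.coeff_monomial, Ne.symm hne] at hc'
        rw [hc'', he, leadExp, dif_pos hδ]
        refine yzExp_lt hδ _ δ.rows.strictMono _ δ.cols.strictMono _ _ hf
          (hf.comp σ.injective) ?_
        rintro ⟨rfl, h2⟩
        refine Finset.ne_of_mem_erase hx (Prod.ext rfl (Equiv.ext fun i => ?_))
        exact hf (congrFun h2 i)
      · simp at hc'
    · rw [value_matYZ_eq_sum, ← Fintype.sum_prod_type',
        ← Finset.add_sum_erase _ _ (Finset.mem_univ (Fin.castLE hδ, 1)),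
        if_pos (Fin.castLE_injective hδ), he, leadExp, dif_pos hδ, Equiv.Perm.sign_one, one_smul]
      rfl
  have hdeg : (yzOrder m n r).degree (MvPolynomial.monomial e (1 : K)) = e := by
    rw [MonomialOrder.degree_monomial, if_neg one_ne_zero]
  have hlt : (yzOrder m n r).degree q ≺[yzOrder m n r]
      (yzOrder m n r).degree (MvPolynomial.monomial e (1 : K)) := by
    rw [hdeg]
    exact (MonomialOrder.degree_lt_iff hpos).2 hq
  rw [hval]
  exact ⟨MonomialOrder.monic_monomial_one.add_of_lt hlt,
    (MonomialOrder.degree_add_of_lt hlt).trans hdeg⟩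

theorem prod_value_matYZ_monic (L : List (Minor m n)) (hL : ∀ δ ∈ L, δ.size ≤ r) :
    (yzOrder m n r).Monic (L.map fun δ => δ.value (matYZ K m n r)).prod ∧
      (yzOrder m n r).degree (L.map fun δ => δ.value (matYZ K m n r)).prod
        = (L.map (leadExp r)).sum := by
  induction L with
  | nil => exact ⟨MonomialOrder.monic_one, by simp⟩
  | cons δ L ih =>
    obtain ⟨h1, h2⟩ := value_matYZ_monic K δ (hL δ (by simp))
    obtain ⟨h3, h4⟩ := ih fun ε hε => hL ε (by simp [hε])
    simp only [List.map_cons, List.prod_cons, List.sum_cons]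
    exact ⟨h1.mul h3, by rw [MonomialOrder.degree_mul h1.ne_zero h3.ne_zero, h2, h4]⟩

end LeadingMonomials

/-! ### Standard bitableaux are independent in `K[Y, Z]` -/

section Independence

variable {m n r : ℕ}

theorem Minor.Le.refl (δ : Minor m n) : δ.Le δ :=
  ⟨le_rfl, fun _ => ⟨le_rfl, le_rfl⟩⟩

theorem Minor.Le.antisymm {δ ε : Minor m n} (h : δ.Le ε) (h' : ε.Le δ) : δ = ε := by
  obtain ⟨t, ht, a, b⟩ := δ
  obtain ⟨u, hu, c, d⟩ := ε
  obtain ⟨h1, h2⟩ := h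
  obtain ⟨h3, h4⟩ := h'
  obtain rfl : t = u := le_antisymm h3 h1
  obtain rfl : a = c := by
    ext i : 1
    exact le_antisymm (h2 i).1 (h4 i).1
  obtain rfl : b = d := by
    ext i : 1
    exact le_antisymm (h2 i).2 (h4 i).2
  rfl

theorem sum_leadExp_ne_zero (L : List (Minor m n)) (s : (Fin m × Fin r) ⊕ (Fin r × Fin n)) :
    (L.map (leadExp r)).sum s ≠ 0 ↔ ∃ ε ∈ L, leadExp r ε s ≠ 0 := by
  induction L with
  | nil => simp
  | cons δ L ih =>
    rw [List.map_cons, List.sum_cons, Finsupp.add_apply, Ne, Nat.add_eq_zero_iff, not_and_or]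
    simp [ih]

/-- The first factor of a standard list is a lower bound for the first factor of any list with
the same leading exponent: the entries of the latter occur, in the same positions, in factors of
the standard list, and the first of these is the least one. -/
theorem le_of_sum_leadExp_eq {δ : Minor m n} {L : List (Minor m n)} {δ' : Minor m n}
    {L' : List (Minor m n)} (hstd : IsStandard (δ :: L)) (hr : ∀ ε ∈ δ :: L, ε.size ≤ r)
    (hr' : δ'.size ≤ r)
    (h : ((δ :: L).map (leadExp r)).sum = ((δ' :: L').map (leadExp r)).sum) : δ.Le δ' := by
  have hmin : ∀ ε ∈ δ :: L, δ.Le ε := by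
    intro ε hε
    rcases List.mem_cons.1 hε with rfl | hε
    · exact Minor.Le.refl _
    · exact List.rel_of_pairwise_cons (List.isChain_iff_pairwise.1 hstd) hε
  have hrow : ∀ i : Fin δ'.size, ∃ hi : (i : ℕ) < δ.size, δ.rows ⟨i, hi⟩ ≤ δ'.rows i := by
    intro i
    have h1 : ((δ' :: L').map (leadExp r)).sum (.inl (δ'.rows i, Fin.castLE hr' i)) ≠ 0 :=
      (sum_leadExp_ne_zero _ _).2 ⟨δ', by simp, (leadExp_inl hr' _).2 ⟨i, rfl, rfl⟩⟩
    rw [← h] at h1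
    obtain ⟨ε, hε, h2⟩ := (sum_leadExp_ne_zero _ _).1 h1
    obtain ⟨j, hj, hj'⟩ := (leadExp_inl (hr ε hε) _).1 h2
    obtain ⟨hle, hle'⟩ := hmin ε hε
    have hij : (j : ℕ) = i := hj'
    refine ⟨by omega, ?_⟩
    have h3 := (hle' j).1
    rw [hj] at h3
    have h4 : (⟨i, by omega⟩ : Fin δ.size) = Fin.castLE hle j := Fin.ext hij.symm
    rw [h4]
    exact h3
  have hcol : ∀ i : Fin δ'.size, ∃ hi : (i : ℕ) < δ.size, δ.cols ⟨i, hi⟩ ≤ δ'.cols i := by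
    intro i
    have h1 : ((δ' :: L').map (leadExp r)).sum (.inr (Fin.castLE hr' i, δ'.cols i)) ≠ 0 :=
      (sum_leadExp_ne_zero _ _).2 ⟨δ', by simp, (leadExp_inr hr' _).2 ⟨i, rfl, rfl⟩⟩
    rw [← h] at h1
    obtain ⟨ε, hε, h2⟩ := (sum_leadExp_ne_zero _ _).1 h1
    obtain ⟨j, hj, hj'⟩ := (leadExp_inr (hr ε hε) _).1 h2
    obtain ⟨hle, hle'⟩ := hmin ε hε
    have hij : (j : ℕ) = i := hj'
    refine ⟨by omega, ?_⟩
    have h3 := (hle' j).2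
    rw [hj] at h3
    have h4 : (⟨i, by omega⟩ : Fin δ.size) = Fin.castLE hle j := Fin.ext hij.symm
    rw [h4]
    exact h3
  have hpos := δ'.size_pos
  obtain ⟨hlast, -⟩ := hrow ⟨δ'.size - 1, by omega⟩
  refine ⟨by simp only at hlast; omega, fun i => ⟨?_, ?_⟩⟩
  · obtain ⟨_, hi⟩ := hrow i; exact hi
  · obtain ⟨_, hi⟩ := hcol i; exact hi

/-- A standard list is determined by its leading exponent: the exponent determines the first
factor, which is the least one. -/
theorem sum_leadExp_injective (L L' : List (Minor m n)) (hL : IsStandard L) (hL' : IsStandard L')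
    (hr : ∀ ε ∈ L, ε.size ≤ r) (hr' : ∀ ε ∈ L', ε.size ≤ r)
    (h : (L.map (leadExp r)).sum = (L'.map (leadExp r)).sum) : L = L' := by
  have hne : ∀ (δ : Minor m n) (M : List (Minor m n)), δ.size ≤ r →
      ((δ :: M).map (leadExp r)).sum ≠ 0 := by
    intro δ M hδ h0
    refine (sum_leadExp_ne_zero (δ :: M)
      (.inl (δ.rows ⟨0, δ.size_pos⟩, (⟨0, δ.size_pos.trans_le hδ⟩ : Fin r)))).2
      ⟨δ, by simp, (leadExp_inl hδ _).2 ⟨⟨0, δ.size_pos⟩, rfl, rfl⟩⟩ ?_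
    rw [h0, Finsupp.zero_apply]
  induction L generalizing L' with
  | nil =>
    cases L' with
    | nil => rfl
    | cons δ' M' => exact absurd h.symm (hne δ' M' (hr' δ' (by simp)))
  | cons δ M ih =>
    cases L' with
    | nil => exact absurd h (hne δ M (hr δ (by simp)))
    | cons δ' M' =>
      obtain rfl : δ = δ' := (le_of_sum_leadExp_eq hL hr (hr' δ' (by simp)) h).antisymm
        (le_of_sum_leadExp_eq hL' hr' (hr δ (by simp)) h.symm)
      rw [List.map_cons, List.map_cons, List.sum_cons, List.sum_cons] at h
      rw [ih M' hL.tail hL'.tail (fun ε hε => hr ε (by simp [hε]))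
        (fun ε hε => hr' ε (by simp [hε])) (add_left_cancel h)]

theorem linearIndependent_value_matYZ (K : Type*) [Field K] (m n r : ℕ) :
    LinearIndependent K fun S : StandardBitableau m n r => S.value (matYZ K m n r) := by
  refine linearIndependent_of_degree_injective (yzOrder m n r) _
    (fun S => (prod_value_matYZ_monic K S.1 S.2.2).1) fun S S' h => Subtype.ext ?_
  refine sum_leadExp_injective S.1 S'.1 S.2.1 S'.2.1 S.2.2 S'.2.2 ?_
  rw [← (prod_value_matYZ_monic K S.1 S.2.2).2, ← (prod_value_matYZ_monic K S'.1 S'.2.2).2]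
  exact h

end Independence

/-! ### The determinantal ring -/

section DetRing

variable (K : Type*) [Field K] {m n r : ℕ}

/-- Minors of size greater than `r` lie in `I_{r+1}`, by Laplace expansion. -/
theorem value_mem_detIdeal (δ : Minor m n) (hδ : r < δ.size) :
    δ.value (Matrix.mvPolynomialX (Fin m) (Fin n) K) ∈ detIdeal K m n (r + 1) := by
  obtain ⟨t, ht, a, b⟩ := δ
  change r + 1 ≤ t at hδ
  change (Matrix.submatrix _ a b).det ∈ _
  induction t, hδ using Nat.le_induction with
  | base => exact Ideal.subset_span ⟨⟨r + 1, ht, a, b⟩, rfl, rfl⟩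
  | succ t hrt ih =>
    rw [Matrix.det_succ_row_zero]
    refine Ideal.sum_mem _ fun j _ => Ideal.mul_mem_left _ _ ?_
    exact ih (by omega) ((Fin.succOrderEmb t).trans a) ((Fin.succAboveOrderEmb j).trans b)

theorem span_standardBitableau_eq_top :
    Submodule.span K (Set.range fun S : StandardBitableau m n r =>
      Ideal.Quotient.mk (detIdeal K m n (r + 1))
        (S.value (Matrix.mvPolynomialX (Fin m) (Fin n) K))) = ⊤ := by
  have hsurj : Function.Surjective (Ideal.Quotient.mkₐ K (detIdeal K m n (r + 1))).toLinearMap :=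
    Ideal.Quotient.mkₐ_surjective K _
  rw [eq_top_iff, ← LinearMap.range_eq_top.2 hsurj, LinearMap.range_eq_map,
    ← span_standard_eq_top K m n, Submodule.map_span]
  refine Submodule.span_le.2 ?_
  rintro _ ⟨_, ⟨L, hL, rfl⟩, rfl⟩
  by_cases hr : ∀ δ ∈ L, δ.size ≤ r
  · exact Submodule.subset_span ⟨⟨L, hL, hr⟩, rfl⟩
  · push Not at hr
    obtain ⟨δ, hδL, hδ⟩ := hr
    have hmem : (L.map fun δ => δ.value (Matrix.mvPolynomialX (Fin m) (Fin n) K)).prod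
        ∈ detIdeal K m n (r + 1) :=
      Ideal.mem_of_dvd _ (List.dvd_prod (List.mem_map_of_mem hδL)) (value_mem_detIdeal K δ hδ)
    have h0 : (Ideal.Quotient.mkₐ K (detIdeal K m n (r + 1))).toLinearMap
        (L.map fun δ => δ.value (Matrix.mvPolynomialX (Fin m) (Fin n) K)).prod = 0 :=
      Ideal.Quotient.eq_zero_iff_mem.2 hmem
    rw [h0]
    exact zero_mem _

theorem genericPoint_value (S : StandardBitableau m n r) :
    (genericPoint K m n r (Ideal.Quotient.mk (detIdeal K m n (r + 1))
      (S.value (Matrix.mvPolynomialX (Fin m) (Fin n) K))) : PolyYZ K m n r)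
      = S.value (matYZ K m n r) := by
  change (substYZ K m n r (S.value _) : PolyYZ K m n r) = _
  simp only [StandardBitableau.value, map_list_prod, List.map_map]
  rw [← Subalgebra.coe_val, map_list_prod, List.map_map]
  refine congrArg List.prod (List.map_congr_left fun δ _ => ?_)
  exact substYZ_value δ

theorem genericPoint_surjective : Function.Surjective (genericPoint K m n r) := by
  have hsub : Function.Surjective (substYZ K m n r) := by
    rintro ⟨x, hx⟩
    have hle : algYZ K m n r ≤ ((algYZ K m n r).val.comp (substYZ K m n r)).range := by
      refine Algebra.adjoin_le ?_
      rintro _ ⟨i, j, rfl⟩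
      exact ⟨MvPolynomial.X (i, j), by simp [substYZ]⟩
    obtain ⟨p, hp⟩ := hle hx
    exact ⟨p, Subtype.ext hp⟩
  intro y
  obtain ⟨p, rfl⟩ := hsub y
  exact ⟨Ideal.Quotient.mk _ p, rfl⟩

end DetRing

end Determinantal

end

theorem corollary3p3 (K : Type*) [Field K] (m n r : ℕ) (hr : 1 ≤ r) (hrm : r ≤ m) (hrn : r ≤ n) :
    Function.Bijective (Determinantal.genericPoint K m n r) ∧
    ∃ b : Module.Basis (Determinantal.StandardBitableau m n r) K (Determinantal.DetRing K m n r),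
      ∀ S : Determinantal.StandardBitableau m n r,
        b S = Ideal.Quotient.mk (Determinantal.detIdeal K m n (r + 1))
          (S.value (Matrix.mvPolynomialX (Fin m) (Fin n) K)) := by
  let φ : Determinantal.DetRing K m n r →ₗ[K] Determinantal.PolyYZ K m n r :=
    ((Determinantal.algYZ K m n r).val.comp (Determinantal.genericPoint K m n r)).toLinearMap
  let e := fun S : Determinantal.StandardBitableau m n r =>
    Ideal.Quotient.mk (Determinantal.detIdeal K m n (r + 1))
      (S.value (Matrix.mvPolynomialX (Fin m) (Fin n) K))
  have hφe : φ ∘ e = fun S => S.value (Determinantal.matYZ K m n r) :=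
    funext fun S => Determinantal.genericPoint_value K S
  have hli : LinearIndependent K (φ ∘ e) := by
    rw [hφe]
    exact Determinantal.linearIndependent_value_matYZ K m n r
  let b := Module.Basis.mk (hli.of_comp φ) (Determinantal.span_standardBitableau_eq_top K).ge
  have hb : ⇑b = e := Module.Basis.coe_mk _ _
  have hinj : Function.Injective φ := by
    refine (injective_iff_map_eq_zero φ).2 fun x hx => ?_
    rw [← b.linearCombination_repr x, Finsupp.apply_linearCombination, hb] at hx
    rw [← b.repr.map_eq_zero_iff]
    exact (linearIndependent_iff.1 hli) _ hx
  exact ⟨⟨fun x y hxy => hinj (congrArg Subtype.val hxy),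
    Determinantal.genericPoint_surjective K⟩, b, fun S => congrFun hb S⟩
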